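/- Let $K\in\mathbb{R}^{n\times n}$ be a nonnegative matrix with $K\mathbf 1=\mathbf 1$, and let $\pi\in\mathbb{R}^n$ be a vector with positive entries such that $\sum_i\pi_i=1$ and $\pi^TK=\pi^T$. Put $D_\pi=\mathrm{diag}(\pi)$, $K^*=D_\pi^{-1}K^TD_\pi$, $\langle x,y\rangle_\pi=\sum_i\pi_ix_iy_i$ and $\|x\|_{\pi,2}^2=\sum_i\pi_i|x_i|^2$, and assume that $K+K^*$ is irreducible. The log-Sobolev constant of $(K,\pi)$ is $$\sigma=\sup\Big\{s\ge 0 \;:\; s\sum_{i}|x_i|^2\log\Big(\frac{|x_i|^2}{\|x\|_{\pi,2}^2}\Big)\pi_i\le\langle x,(I-K)x\rangle_\pi\ \text{ for all } x\in\mathbb{R}^n \text{ with positive entries}\Big\}\in[0,\infty].$$ For $x,y\in\mathbb{R}^n_+$ (nonnegative vectors) write $x\sim y$ if $cy\le x\le Cy$ entrywise for some $c,C>0$, and put $M(x/y)=\inf\{C>0: x\le Cy\}$. Let $d_H(0,0)=0$, let $d_H(x,y)=\ln\big(M(x/y)M(y/x)\big)$ if $x\sim y$ and $x,y\neq0$,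 and let $d_H(x,y)=\infty$ otherwise. For a matrix $A\in\mathbb{R}^{n\times n}$ with nonnegative entries let $$\kappa_H(A)=\inf\{C>0: d_H(Ax,Ay)\le C\,d_H(x,y)\ \text{ for all } x,y\in\mathbb{R}^n_+ \text{ with } x\sim y\}.$$ For $t\ge0$ let $\rho(t)=\kappa_H\big(\exp(\tfrac t2(K+K^*))\big)$. Then the limit $\lim_{t\to0^+}\rho(t)^{-1/t}$ exists in $[0,\infty]$, it is finite if $n\ge2$, and $$\lim_{t\to0^+}\rho(t)^{-1/t}\le e^{2\sigma},$$ where for $n=1$, in which case $\rho\equiv0$ and $\sigma=\infty$, both sides are read as $+\infty$. -/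

import Mathlib

open Filter Topology
open scoped NNReal ENNReal Matrix

noncomputable section

namespace BirkhoffLogSobolev

variable {ι κ : Type*}

/-! ### Hilbert's projective metric on the nonnegative orthant and the Birkhoff ratio -/

/-- Two vectors of the nonnegative orthant are comparable, `x ∼ y`, if `c y ≤ x ≤ C y`
entrywise for some `c, C > 0`. -/
def Comparable (x y : ι → ℝ) : Prop :=
  0 ≤ x ∧ 0 ≤ y ∧ ∃ c C : ℝ, 0 < c ∧ 0 < C ∧ c • y ≤ x ∧ x ≤ C • y

/-- `M(x/y) = inf {C > 0 : x ≤ C y}`. It is only used for comparable `x`, `y`, where the set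
is nonempty. -/
def upperRatio (x y : ι → ℝ) : ℝ :=
  sInf {C : ℝ | 0 < C ∧ x ≤ C • y}

open scoped Classical in
/-- Hilbert's projective metric `d_H` on the nonnegative orthant, with values in `[0, ∞]`. For
comparable nonzero `x`, `y` the logarithm is nonnegative. -/
def hilbertDist (x y : ι → ℝ) : ℝ≥0∞ :=
  if x = 0 ∧ y = 0 then 0
  else if Comparable x y then ENNReal.ofReal (Real.log (upperRatio x y * upperRatio y x))
  else ⊤

/-- The Birkhoff contraction ratio `κ_H(F) ∈ [0, ∞]` of a map on the nonnegative orthant: the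
infimum of all `C > 0` with `d_H(F x, F y) ≤ C d_H(x, y)` for all `x ∼ y` in the orthant. -/
def birkhoffRatio (F : (ι → ℝ) → (κ → ℝ)) : ℝ≥0∞ :=
  ⨅ (C : ℝ≥0) (_ : 0 < C)
    (_ : ∀ x y : ι → ℝ, Comparable x y → hilbertDist (F x) (F y) ≤ C * hilbertDist x y),
    (C : ℝ≥0∞)

/-! ### Finite Markov chains and the logarithmic Sobolev constant -/

variable [Fintype ι] [DecidableEq ι]

/-- `(K, π)` is a finite Markov chain: `K` is a stochastic matrix and `π` is a stationary
probability vector of `K`. -/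
structure IsMarkovChain (K : Matrix ι ι ℝ) (π : ι → ℝ) : Prop where
  stochastic : K ∈ Matrix.rowStochastic ℝ ι
  prob : π ∈ stdSimplex ℝ ι
  stationary : π ᵥ* K = π

/-- The adjoint `M* = D_π⁻¹ Mᵀ D_π` of `M` for the inner product `⟨·,·⟩_π` (`π` positive). -/
def adj (π : ι → ℝ) (M : Matrix ι ι ℝ) : Matrix ι ι ℝ :=
  Matrix.diagonal (fun i => (π i)⁻¹) * Mᵀ * Matrix.diagonal π

/-- The weighted inner product `⟨x, y⟩_π = ⟨D_π x, y⟩`. -/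
def inn (π x y : ι → ℝ) : ℝ := (Matrix.diagonal π *ᵥ x) ⬝ᵥ y

/-- The square `‖x‖_{π,2}²` of the weighted `ℓ²`-norm. -/
def normSq (π x : ι → ℝ) : ℝ := ∑ i, π i * |x i| ^ 2

/-- The Dirichlet form `𝒟(x, y) = ⟨x, (I - K) y⟩_π`. -/
def dirichlet (K : Matrix ι ι ℝ) (π x y : ι → ℝ) : ℝ := inn π x ((1 - K) *ᵥ y)

/-- The entropy `ℰ(x) = ∑ i, |x_i|² log(|x_i|² / ‖x‖_{π,2}²) π_i`. -/
def entropy (π x : ι → ℝ) : ℝ :=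
  ∑ i, |x i| ^ 2 * Real.log (|x i| ^ 2 / normSq π x) * π i

/-- The logarithmic Sobolev constant
`σ = sup {s ≥ 0 : s ℰ(x) ≤ 𝒟(x, x) for all positive x}`, a supremum in `[0, ∞]`. -/
def logSobolev (K : Matrix ι ι ℝ) (π : ι → ℝ) : ℝ≥0∞ :=
  ⨆ (s : ℝ≥0) (_ : ∀ x : ι → ℝ, (∀ i, 0 < x i) → (s : ℝ) * entropy π x ≤ dirichlet K π x x),
    (s : ℝ≥0∞)

/-- `ρ(t) = κ_H(exp((t/2) (K + K*)))`. -/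
def rho (K : Matrix ι ι ℝ) (π : ι → ℝ) (t : ℝ) : ℝ≥0∞ :=
  birkhoffRatio fun x : ι → ℝ => NormedSpace.exp ((t / 2) • (K + adj π K)) *ᵥ x

end BirkhoffLogSobolev

end

/-! Write `A = K + K*`. Nonnegative matrices do not expand Hilbert's metric, so `ρ ≤ 1` and `ρ` is
submultiplicative. Fekete's argument (`tendsto_rpow_neg_inv_of_submultiplicative`) then makes the
limit `L` equal to the infimum of `ρ(t)^(-1/t)` over `t > 0`. Hence `e^l < L` gives `ρ(t) ≤ e^(-lt)`
for every `t > 0`, and it suffices to derive the log-Sobolev inequality for every `s < l/2`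
(`mul_entropy_le_dirichlet`).

Minimize `𝒟 - sℰ` over nonnegative unit vectors. The minimizer `x` is positive by irreducibility,
and its Euler–Lagrange equation reads `(Ax)_k / x_k = 2 - 4s log x_k - 2m`, with `m` the minimum.
The ray of `1` is fixed by the semigroup because `A1 = 2·1`; differentiating the contraction of the
distance from `x` to `1` at `t = 0` gives `(Ax)_i / x_i - (Ax)_j / x_j ≤ -2l log(x_i / x_j)` at a
maximal coordinate `i` and a minimal `j` (`mulVec_div_sub_le`). Together, `(2l - 4s) log(x_i / x_j)
≤ 0`, so `x` is constant, `m = 0` and `sℰ ≤ 𝒟`.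

Finiteness for at least two states holds because a nonconstant positive vector has positive entropy,
which bounds `σ`. -/

namespace BirkhoffLogSobolev

/-! ### Hilbert's metric and Birkhoff ratios, followed by Fekete's lemma. -/

section HilbertMetric

variable {ι κ ν : Type*} {x y : ι → ℝ}

lemma Comparable.symm (h : Comparable x y) : Comparable y x := by
  obtain ⟨hx, hy, c, C, hc, hC, h₁, h₂⟩ := h
  refine ⟨hy, hx, C⁻¹, c⁻¹, by positivity, by positivity, ?_, ?_⟩
  · exact (inv_smul_le_iff_of_pos hC).2 h₂
  · exact (le_inv_smul_iff_of_pos hc).2 h₁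

lemma comparable_of_pos [Finite ι] (hx : ∀ i, 0 < x i) (hy : ∀ i, 0 < y i) :
    Comparable x y := by
  have key : ∀ u v : ι → ℝ, (∀ i, 0 < u i) → (∀ i, 0 < v i) → ∃ C : ℝ, 0 < C ∧ u ≤ C • v := by
    intro u v hu hv
    obtain ⟨C, hC⟩ := (Set.finite_range fun i => u i / v i).bddAbove
    refine ⟨max C 1, by positivity, fun i => ?_⟩
    have h := (hC ⟨i, rfl⟩).trans (le_max_left C 1)
    simpa [div_le_iff₀ (hv i)] using h
  obtain ⟨C, hC, h₁⟩ := key x y hx hy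
  obtain ⟨c, hc, h₂⟩ := key y x hy hx
  exact ⟨fun i => (hx i).le, fun i => (hy i).le, c⁻¹, C, by positivity, hC,
    (inv_smul_le_iff_of_pos hc).2 h₂, h₁⟩

lemma upperRatio_nonneg (x y : ι → ℝ) : 0 ≤ upperRatio x y :=
  Real.sInf_nonneg fun _ h => h.1.le

lemma upperRatio_le {C : ℝ} (hC : 0 < C) (h : x ≤ C • y) : upperRatio x y ≤ C :=
  csInf_le ⟨0, fun _ h => h.1.le⟩ ⟨hC, h⟩

/-- The infimum is attained: coordinates with `y i > 0` bound every admissible constant below by `x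
i / y i`, and where `y i = 0` comparability forces `x i ≤ 0`. -/
lemma Comparable.le_upperRatio_smul (h : Comparable x y) : x ≤ upperRatio x y • y := by
  obtain ⟨-, hy, -, C, -, hC, -, hxy⟩ := h
  intro i
  rcases (hy i).eq_or_lt with h0 | h0
  · have := hxy i
    simp_all [← h0]
  · rw [Pi.smul_apply, smul_eq_mul, ← div_le_iff₀ h0]
    refine le_csInf ⟨C, hC, hxy⟩ fun B hB => ?_
    rw [div_le_iff₀ h0]
    exact hB.2 i

lemma Comparable.eq_zero_iff (h : Comparable x y) : x = 0 ↔ y = 0 := by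
  have key : ∀ {u v : ι → ℝ}, Comparable u v → v = 0 → u = 0 := by
    rintro u v ⟨hu, -, -, C, -, -, -, huv⟩ rfl
    exact le_antisymm (by simpa using huv) hu
  exact ⟨key h.symm, key h⟩

lemma Comparable.upperRatio_pos (h : Comparable x y) (hx : x ≠ 0) : 0 < upperRatio x y := by
  refine (upperRatio_nonneg x y).lt_of_ne fun h0 => hx (le_antisymm ?_ h.1)
  simpa [← h0] using h.le_upperRatio_smul

lemma Comparable.hilbertDist_eq (h : Comparable x y) (hx : x ≠ 0) :
    hilbertDist x y = ENNReal.ofReal (Real.log (upperRatio x y * upperRatio y x)) := by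
  simp [hilbertDist, hx, h]

lemma Comparable.hilbertDist_ne_top (h : Comparable x y) : hilbertDist x y ≠ ⊤ := by
  unfold hilbertDist
  split_ifs <;> simp

/-- The ratio `κ_H(F)` is itself an admissible constant. -/
lemma hilbertDist_le_birkhoffRatio_mul {F : (ι → ℝ) → (κ → ℝ)} (h : Comparable x y)
    (hF : birkhoffRatio F ≠ ⊤) :
    hilbertDist (F x) (F y) ≤ birkhoffRatio F * hilbertDist x y := by
  -- Let admissible constants decrease to the infimum; multiplication by the distance is continuous
  -- here because comparable vectors are at finite distance.
  have hlim : Tendsto (fun c : ℝ≥0∞ => c * hilbertDist x y) (𝓝[>] birkhoffRatio F)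
      (𝓝 (birkhoffRatio F * hilbertDist x y)) :=
    (ENNReal.Tendsto.mul_const tendsto_id (Or.inr h.hilbertDist_ne_top)).mono_left
      nhdsWithin_le_nhds
  have : (𝓝[>] birkhoffRatio F).NeBot := nhdsGT_neBot_of_exists_gt ⟨⊤, hF.lt_top⟩
  refine ge_of_tendsto hlim ?_
  filter_upwards [self_mem_nhdsWithin] with c hc
  simp only [Set.mem_Ioi, birkhoffRatio, iInf_lt_iff] at hc
  obtain ⟨C, -, hC, hCc⟩ := hc
  exact (hC x y h).trans (by gcongr)

/-- The value `c = 0` is allowed although the infimum runs over `C > 0`: each larger finite `a` is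
admissible, and `a` decreases to `c`. -/
lemma birkhoffRatio_le {F : (ι → ℝ) → (κ → ℝ)} {c : ℝ≥0∞}
    (h : ∀ x y, Comparable x y → hilbertDist (F x) (F y) ≤ c * hilbertDist x y) :
    birkhoffRatio F ≤ c := by
  refine le_of_forall_gt_imp_ge_of_dense fun a ha => ?_
  rcases eq_or_ne a ⊤ with rfl | ha'
  · exact le_top
  lift a to ℝ≥0 using ha'
  refine iInf_le_of_le a (iInf_le_of_le ?_ (iInf_le_of_le (fun x y hxy => ?_) le_rfl))
  · exact ENNReal.coe_pos.1 (bot_le.trans_lt ha)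
  · exact (h x y hxy).trans (by gcongr)

/-- Birkhoff ratios are submultiplicative. -/
lemma birkhoffRatio_comp_le {F : (κ → ℝ) → (ν → ℝ)} {G : (ι → ℝ) → (κ → ℝ)}
    (hF : birkhoffRatio F ≠ ⊤) (hG : birkhoffRatio G ≠ ⊤)
    (hcomp : ∀ x y, Comparable x y → Comparable (G x) (G y)) :
    birkhoffRatio (fun x => F (G x)) ≤ birkhoffRatio F * birkhoffRatio G := by
  refine birkhoffRatio_le fun x y h => ?_
  calc _ ≤ birkhoffRatio F * hilbertDist (G x) (G y) :=
        hilbertDist_le_birkhoffRatio_mul (hcomp x y h) hF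
    _ ≤ birkhoffRatio F * (birkhoffRatio G * hilbertDist x y) := by
        gcongr
        exact hilbertDist_le_birkhoffRatio_mul h hG
    _ = _ := (mul_assoc ..).symm

section Matrix

variable [Fintype ι] {A : Matrix κ ι ℝ}

lemma mulVec_mono (hA : ∀ i j, 0 ≤ A i j) (h : x ≤ y) : A *ᵥ x ≤ A *ᵥ y :=
  fun i => Finset.sum_le_sum fun j _ => mul_le_mul_of_nonneg_left (h j) (hA i j)

lemma Comparable.mulVec (hA : ∀ i j, 0 ≤ A i j) (h : Comparable x y) :
    Comparable (A *ᵥ x) (A *ᵥ y) := by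
  obtain ⟨hx, hy, c, C, hc, hC, h₁, h₂⟩ := h
  refine ⟨?_, ?_, c, C, hc, hC, ?_, ?_⟩
  · simpa using mulVec_mono hA hx
  · simpa using mulVec_mono hA hy
  · simpa [Matrix.mulVec_smul] using mulVec_mono hA h₁
  · simpa [Matrix.mulVec_smul] using mulVec_mono hA h₂

lemma Comparable.upperRatio_mulVec_le (hA : ∀ i j, 0 ≤ A i j) (h : Comparable x y)
    (hx : x ≠ 0) : upperRatio (A *ᵥ x) (A *ᵥ y) ≤ upperRatio x y := by
  refine upperRatio_le (h.upperRatio_pos hx) ?_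
  simpa [Matrix.mulVec_smul] using mulVec_mono hA h.le_upperRatio_smul

/-- Nonnegative matrices are nonexpansive in Hilbert's metric. -/
lemma birkhoffRatio_mulVec_le_one (hA : ∀ i j, 0 ≤ A i j) :
    birkhoffRatio (fun x => A *ᵥ x) ≤ 1 := by
  refine birkhoffRatio_le fun x y h => ?_
  rw [one_mul]
  have hAxy := h.mulVec hA
  by_cases h0 : A *ᵥ x = 0
  · simp [hilbertDist, h0, hAxy.eq_zero_iff.1 h0]
  have hx : x ≠ 0 := by
    rintro rfl
    simp at h0
  have hy : y ≠ 0 := fun hy => hx (h.eq_zero_iff.2 hy)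
  have h0' : A *ᵥ y ≠ 0 := fun hy => h0 (hAxy.eq_zero_iff.2 hy)
  rw [h.hilbertDist_eq hx, hAxy.hilbertDist_eq h0]
  refine ENNReal.ofReal_le_ofReal (Real.log_le_log
    (mul_pos (hAxy.upperRatio_pos h0) (hAxy.symm.upperRatio_pos h0')) ?_)
  exact mul_le_mul (h.upperRatio_mulVec_le hA hx) (h.symm.upperRatio_mulVec_le hA hy)
    (upperRatio_nonneg _ _) (upperRatio_nonneg _ _)

end Matrix

variable [Finite ι]

/-- Any two coordinates bound the distance from below, and extremal ones bound the distance to `1`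
from above (`hilbertDist_one_le`). A fixed pair thus turns contraction into an inequality between
functions differentiable in time. -/
lemma ofReal_log_ratio_le_hilbertDist (hx : ∀ i, 0 < x i) (hy : ∀ i, 0 < y i) (i j : ι) :
    ENNReal.ofReal (Real.log (x i / y i * (y j / x j))) ≤ hilbertDist x y := by
  have h := comparable_of_pos hx hy
  have hx0 : x ≠ 0 := fun h0 => (hx i).ne' (congrFun h0 i)
  rw [h.hilbertDist_eq hx0]
  have hxi := hx i
  have hyi := hy i
  have hxj := hx j
  have hyj := hy j
  refine ENNReal.ofReal_le_ofReal (Real.log_le_log (by positivity) ?_)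
  refine mul_le_mul ?_ ?_ (by positivity) (upperRatio_nonneg _ _)
  · rw [div_le_iff₀ hyi]
    exact h.le_upperRatio_smul i
  · rw [div_le_iff₀ hxj]
    exact h.symm.le_upperRatio_smul j

lemma hilbertDist_one_le (hx : ∀ i, 0 < x i) {i j : ι} (hi : ∀ k, x k ≤ x i)
    (hj : ∀ k, x j ≤ x k) :
    hilbertDist x 1 ≤ ENNReal.ofReal (Real.log (x i / x j)) := by
  have h : Comparable x 1 := comparable_of_pos hx fun _ => one_pos
  have hx0 : x ≠ 0 := fun h0 => (hx i).ne' (congrFun h0 i)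
  have h1 : (1 : ι → ℝ) ≠ 0 := fun h0 => one_ne_zero (congrFun h0 i)
  rw [h.hilbertDist_eq hx0, div_eq_mul_inv]
  refine ENNReal.ofReal_le_ofReal (Real.log_le_log
    (mul_pos (h.upperRatio_pos hx0) (h.symm.upperRatio_pos h1)) ?_)
  refine mul_le_mul ?_ ?_ (upperRatio_nonneg _ _) (hx i).le
  · exact upperRatio_le (hx i) fun k => by simpa using hi k
  · refine upperRatio_le (inv_pos.2 (hx j)) fun k => ?_
    have := hx j
    rw [Pi.smul_apply, smul_eq_mul, Pi.one_apply, inv_mul_eq_div, one_le_div this]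
    exact hj k

end HilbertMetric

/-- A continuous-time form of Fekete's lemma. -/
theorem tendsto_rpow_neg_inv_of_submultiplicative {r : ℝ → ℝ≥0∞} (h1 : ∀ t, 0 ≤ t → r t ≤ 1)
    (hmul : ∀ s t, 0 ≤ s → 0 ≤ t → r (s + t) ≤ r s * r t) :
    Tendsto (fun t : ℝ => r t ^ (-1 / t)) (𝓝[>] 0) (𝓝 (⨅ (t : ℝ) (_ : 0 < t), r t ^ (-1 / t))) := by
  -- The remainder `s` costs nothing, since `r s ≤ 1`.
  have hpow : ∀ t, 0 ≤ t → ∀ s, 0 ≤ s → ∀ n : ℕ, r (n * t + s) ≤ r t ^ n := by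
    intro t ht s hs n
    induction n with
    | zero => simpa using h1 s hs
    | succ n ih =>
      have e : ((n + 1 : ℕ) : ℝ) * t + s = (n * t + s) + t := by push_cast; ring
      rw [e, pow_succ]
      exact (hmul _ _ (by positivity) ht).trans (by gcongr)
  refine tendsto_order.2 ⟨fun a ha => ?_, fun a ha => ?_⟩
  · filter_upwards [self_mem_nhdsWithin] with t ht
    exact ha.trans_le (iInf₂_le t ht)
  · simp only [iInf_lt_iff] at ha
    obtain ⟨u, hu, hua⟩ := ha
    have hu0 : r u ≠ 0 := by
      intro h0
      rw [h0, ENNReal.zero_rpow_of_neg (by rw [neg_div]; simpa using hu)] at hua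
      exact not_top_lt hua
    have hu1 := h1 u hu.le
    -- With `n = ⌊u/t⌋`, `r u ≤ (r t)^n` and `u - t < n t ≤ u`; as `r u ≤ 1`, replacing `n t` by `u
    -- - t` in the exponent only increases the bound.
    have hbound : ∀ t, 0 < t → t < u → r t ^ (-1 / t) ≤ r u ^ (-1 / (u - t)) := by
      intro t ht htu
      set n := ⌊u / t⌋₊
      have hn1 : u - t < n * t := by
        have := Nat.lt_floor_add_one (u / t)
        rw [div_lt_iff₀ ht] at this
        linarith
      have hn2 : n * t ≤ u := by
        have := Nat.floor_le (div_nonneg hu.le ht.le)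
        rwa [le_div_iff₀ ht] at this
      have hn0 : (0 : ℝ) < n := by
        by_contra hcon
        have : (n : ℝ) * t ≤ 0 := mul_nonpos_of_nonpos_of_nonneg (not_lt.1 hcon) ht.le
        linarith
      have hr : r u ≤ r t ^ (n : ℝ) := by
        have := hpow t ht.le (u - n * t) (by linarith) n
        rw [ENNReal.rpow_natCast]
        simpa using this
      calc r t ^ (-1 / t) = (r t ^ (n : ℝ)) ^ (-(1 / (n * t))) := by
            rw [← ENNReal.rpow_mul]
            congr 1
            field_simp
        _ ≤ r u ^ (-(1 / (n * t))) := by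
            rw [ENNReal.rpow_neg, ENNReal.rpow_neg]
            exact ENNReal.inv_le_inv.2 (ENNReal.rpow_le_rpow hr (by positivity))
        _ ≤ _ := by
            refine ENNReal.rpow_le_rpow_of_exponent_ge hu1 ?_
            rw [neg_div]
            exact neg_le_neg (one_div_le_one_div_of_le (by linarith) hn1.le)
    have hlim : Tendsto (fun t => r u ^ (-1 / (u - t))) (𝓝[>] 0) (𝓝 (r u ^ (-1 / u))) := by
      have hne : r u ≠ ⊤ := (hu1.trans_lt ENNReal.one_lt_top).ne
      have hpos : 0 < (r u).toReal := ENNReal.toReal_pos hu0 hne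
      have e : ∀ z : ℝ, r u ^ z = ENNReal.ofReal ((r u).toReal ^ z) := by
        intro z
        rw [← ENNReal.ofReal_rpow_of_pos hpos, ENNReal.ofReal_toReal hne]
      simp only [e]
      have hc : ContinuousAt (fun t => (r u).toReal ^ (-1 / (u - t))) 0 := by
        refine ContinuousAt.rpow continuousAt_const ?_ (Or.inl hpos.ne')
        exact continuousAt_const.div (continuousAt_const.sub continuousAt_id) (by simpa using hu.ne')
      have := hc.tendsto
      rw [sub_zero] at this
      exact (ENNReal.tendsto_ofReal this).mono_left nhdsWithin_le_nhds
    filter_upwards [hlim.eventually (gt_mem_nhds hua), Ioo_mem_nhdsGT hu] with t h₁ h₂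
    exact (hbound t h₂.1 h₂.2).trans_lt h₁

/-! ### The matrix exponential and infinitesimal contraction. -/

section Semigroup

variable {ι : Type*} [Fintype ι] [DecidableEq ι]

lemma exp_apply_nonneg {A : Matrix ι ι ℝ} (hA : ∀ i j, 0 ≤ A i j) (i j : ι) :
    0 ≤ NormedSpace.exp A i j := by
  let : NormedRing (Matrix ι ι ℝ) := Matrix.linftyOpNormedRing
  let : NormedAlgebra ℝ (Matrix ι ι ℝ) := Matrix.linftyOpNormedAlgebra
  have hpow : ∀ n : ℕ, ∀ i j, 0 ≤ (A ^ n) i j := by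
    intro n
    induction n with
    | zero => intro i j; rw [pow_zero, Matrix.one_apply]; split_ifs <;> simp
    | succ n ih =>
      intro i j
      rw [pow_succ, Matrix.mul_apply]
      exact Finset.sum_nonneg fun k _ => mul_nonneg (ih i k) (hA k j)
  have h := NormedSpace.exp_series_hasSum_exp' (𝕂 := ℝ) A
  have h' := Pi.hasSum.1 (Pi.hasSum.1 h i) j
  exact h'.nonneg fun n => mul_nonneg (by positivity) (hpow n i j)

lemma hasDerivAt_exp_smul_mulVec (A : Matrix ι ι ℝ) (x : ι → ℝ) (i : ι) :
    HasDerivAt (fun t : ℝ => (NormedSpace.exp (t • A) *ᵥ x) i) ((A *ᵥ x) i) 0 := by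
  let : NormedRing (Matrix ι ι ℝ) := Matrix.linftyOpNormedRing
  let : NormedAlgebra ℝ (Matrix ι ι ℝ) := Matrix.linftyOpNormedAlgebra
  have h := hasDerivAt_exp_smul_const (𝕂 := ℝ) A (0 : ℝ)
  rw [zero_smul, NormedSpace.exp_zero, one_mul] at h
  let φ : Matrix ι ι ℝ →ₗ[ℝ] ℝ :=
    { toFun := fun M => (M *ᵥ x) i
      map_add' := fun M N => by simp [Matrix.add_mulVec]
      map_smul' := fun c M => by simp [Matrix.smul_mulVec] }
  exact φ.toContinuousLinearMap.hasFDerivAt.comp_hasDerivAt (0 : ℝ) h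

lemma nonneg_of_hasDerivAt_zero {f : ℝ → ℝ} {f' : ℝ} (hf : HasDerivAt f f' 0) (h0 : f 0 = 0)
    (hpos : ∀ᶠ t in 𝓝[>] 0, 0 ≤ f t) : 0 ≤ f' := by
  refine ge_of_tendsto hf.tendsto_slope_zero_right ?_
  filter_upwards [hpos, self_mem_nhdsWithin] with t ht ht0
  rw [zero_add, h0, sub_zero]
  exact mul_nonneg (inv_nonneg.2 (le_of_lt ht0)) ht

/-- The infinitesimal form of exponential contraction in Hilbert's metric, at the coordinates where
the ratio to the constant vector is extremal. -/
lemma mulVec_div_sub_le {A : Matrix ι ι ℝ} {c l : ℝ}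
    (hA1 : ∀ i, (A *ᵥ 1) i = c)
    (hl : ∀ t : ℝ, 0 < t →
      birkhoffRatio (fun x : ι → ℝ => NormedSpace.exp ((t / 2) • A) *ᵥ x)
        ≤ ENNReal.ofReal (Real.exp (-(l * t))))
    {x : ι → ℝ} (hx : ∀ i, 0 < x i) {i j : ι} (hi : ∀ k, x k ≤ x i) (hj : ∀ k, x j ≤ x k) :
    (A *ᵥ x) i / x i - (A *ᵥ x) j / x j ≤ -(2 * l * Real.log (x i / x j)) := by
  let u : (ι → ℝ) → ℝ → ι → ℝ := fun y t => NormedSpace.exp ((t / 2) • A) *ᵥ y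
  have u0 : ∀ y, u y 0 = y := fun y => by simp [u]
  have hu : ∀ y k, HasDerivAt (fun t => u y t k) ((A *ᵥ y) k / 2) 0 := by
    intro y k
    have h := hasDerivAt_exp_smul_mulVec A y k
    rw [← zero_div (2 : ℝ)] at h
    have h2 : HasDerivAt (fun t : ℝ => t / 2) (1 / 2) 0 := (hasDerivAt_id 0).div_const 2
    have := h.comp (0 : ℝ) h2
    rw [mul_one_div] at this
    exact this
  have hpos : ∀ y, (∀ k, 0 < y k) → ∀ᶠ t in 𝓝[>] (0 : ℝ), ∀ k, 0 < u y t k := by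
    intro y hy
    refine eventually_all.2 fun k => ?_
    refine ((hu y k).continuousAt.eventually (lt_mem_nhds ?_)).filter_mono nhdsWithin_le_nhds
    simpa [u0] using hy k
  have hd : 0 ≤ Real.log (x i / x j) := Real.log_nonneg ((one_le_div (hx j)).2 (hi j))
  -- The slack in the contraction estimate at the coordinates `i`, `j`: zero at `t = 0` and
  -- nonnegative just after, so its derivative at `0` is nonnegative.
  let f : ℝ → ℝ := fun t => Real.exp (-(l * t)) * Real.log (x i / x j) -
    Real.log (u x t i / u 1 t i * (u 1 t j / u x t j))
  have hf0 : f 0 = 0 := by simp [f, u0, div_eq_mul_inv]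
  have hf : ∀ᶠ t in 𝓝[>] 0, 0 ≤ f t := by
    filter_upwards [hpos x hx, hpos 1 fun _ => one_pos, self_mem_nhdsWithin] with t h₁ h₂ ht
    have h3 := ofReal_log_ratio_le_hilbertDist h₁ h₂ i j
    have hlt := hl t ht
    have h4 := hilbertDist_le_birkhoffRatio_mul
      (comparable_of_pos hx fun _ => one_pos) (hlt.trans_lt ENNReal.ofReal_lt_top).ne
    have h5 : ENNReal.ofReal (Real.log (u x t i / u 1 t i * (u 1 t j / u x t j))) ≤
        ENNReal.ofReal (Real.exp (-(l * t)) * Real.log (x i / x j)) := by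
      rw [ENNReal.ofReal_mul (Real.exp_nonneg _)]
      exact h3.trans (h4.trans (mul_le_mul' hlt (hilbertDist_one_le hx hi hj)))
    exact sub_nonneg.2
      ((ENNReal.ofReal_le_ofReal_iff (mul_nonneg (Real.exp_nonneg _) hd)).1 h5)
  have hxi := (hx i).ne'
  have hxj := (hx j).ne'
  have hderiv : HasDerivAt f (-l * Real.log (x i / x j) -
      ((A *ᵥ x) i / x i - (A *ᵥ x) j / x j) / 2) 0 := by
    have h1 : HasDerivAt (fun t : ℝ => Real.exp (-(l * t))) (-l) 0 := by
      have := (((hasDerivAt_id (0 : ℝ)).const_mul l).neg).exp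
      simpa using this
    have h2 := ((hu x i).div (hu 1 i) (by simp [u0])).mul
      ((hu 1 j).div (hu x j) (by simpa [u0] using hxj))
    have h3 := h2.log (by simp [u0, hxi, hxj])
    convert! (h1.mul_const (Real.log (x i / x j))).sub h3 using 1
    -- The two contributions of the vector `1` cancel because `A1` is constant.
    simp only [Pi.mul_apply, Pi.div_apply, u0, Pi.one_apply, hA1]
    field_simp
    ring
  have := nonneg_of_hasDerivAt_zero hderiv hf0 hf
  linarith

end Semigroup

/-! ### The generator `K + K*` and the function `ρ`. -/

section MarkovChain

variable {ι : Type*} [Fintype ι] [DecidableEq ι] {K : Matrix ι ι ℝ} {π : ι → ℝ}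

lemma adj_apply (M : Matrix ι ι ℝ) (i j : ι) : adj π M i j = (π i)⁻¹ * M j i * π j := by
  simp [adj, Matrix.mul_diagonal, Matrix.diagonal_mul]

/-- `K1 = 1` is stochasticity, while `K*1 = 1` is the stationarity of `π`. -/
lemma IsMarkovChain.add_adj_mulVec_one (hK : IsMarkovChain K π) (hπ : ∀ i, 0 < π i) (i : ι) :
    ((K + adj π K) *ᵥ 1) i = 2 := by
  have h1 : (K *ᵥ 1) i = 1 := congrFun hK.stochastic.2 i
  have h2 : (adj π K *ᵥ 1) i = 1 := by
    have := congrFun hK.stationary i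
    simp only [Matrix.vecMul, dotProduct] at this
    simp only [Matrix.mulVec, dotProduct, adj_apply, Pi.one_apply, mul_one, mul_assoc]
    rw [← Finset.mul_sum, ← inv_mul_cancel₀ (hπ i).ne']
    congr 1
    simpa only [mul_comm] using this
  rw [Matrix.add_mulVec, Pi.add_apply, h1, h2]
  norm_num

variable (hA : ∀ i j, 0 ≤ (K + adj π K) i j)
include hA

lemma rho_exp_apply_nonneg {t : ℝ} (ht : 0 ≤ t) (i j : ι) :
    0 ≤ NormedSpace.exp ((t / 2) • (K + adj π K)) i j :=
  exp_apply_nonneg (fun i j => mul_nonneg (by positivity) (hA i j)) i j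

lemma rho_le_one (t : ℝ) (ht : 0 ≤ t) : rho K π t ≤ 1 :=
  birkhoffRatio_mulVec_le_one (rho_exp_apply_nonneg hA ht)

lemma rho_add_le (s t : ℝ) (hs : 0 ≤ s) (ht : 0 ≤ t) :
    rho K π (s + t) ≤ rho K π s * rho K π t := by
  have h := birkhoffRatio_comp_le
    ((rho_le_one hA s hs).trans_lt ENNReal.one_lt_top).ne
    ((rho_le_one hA t ht).trans_lt ENNReal.one_lt_top).ne
    fun x y hxy => hxy.mulVec (rho_exp_apply_nonneg hA ht)
  refine le_trans (le_of_eq ?_) h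
  unfold rho
  congr 1
  ext1 x
  rw [Matrix.mulVec_mulVec, ← Matrix.exp_add_of_commute, ← add_smul, add_div]
  exact ((Commute.refl _).smul_left _).smul_right _

end MarkovChain

/-- Differentiability at `z = 0` matters because the minimizer may a priori have zero coordinates;
there the difference quotient is `2 t log t → 0`. -/
lemma hasDerivAt_sq_mul_log_sq (z : ℝ) :
    HasDerivAt (fun z : ℝ => z ^ 2 * Real.log (z ^ 2)) (2 * z * Real.log (z ^ 2) + 2 * z) z := by
  rcases eq_or_ne z 0 with rfl | hz
  · rw [hasDerivAt_iff_tendsto_slope_zero]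
    have h : Tendsto (fun t : ℝ => 2 * (t * Real.log t)) (𝓝[≠] 0) (𝓝 0) := by
      have := (Real.continuous_mul_log.tendsto 0).const_mul 2
      simp only [zero_mul, mul_zero] at this
      exact this.mono_left nhdsWithin_le_nhds
    simp only [mul_zero, zero_mul, add_zero]
    refine h.congr' ?_
    filter_upwards [self_mem_nhdsWithin] with t ht
    have ht' : t ≠ 0 := ht
    simp only [zero_add, Real.log_pow, smul_eq_mul]
    field_simp
    push_cast
    ring
  · have := HasDerivAt.comp (h₂ := fun y => y * Real.log y) (h := fun y => y ^ 2) z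
      (Real.hasDerivAt_mul_log (pow_ne_zero 2 hz)) (hasDerivAt_pow 2 z)
    convert! this using 1
    simp
    ring

lemma hasDerivAt_coord {ι : Type*} [DecidableEq ι] (x : ι → ℝ) (i k : ι) :
    HasDerivAt (fun u : ℝ => (x + u • (Pi.single i 1 : ι → ℝ)) k) ((Pi.single i 1 : ι → ℝ) k) 0 := by
  simpa using ((hasDerivAt_id (0 : ℝ)).mul_const ((Pi.single i (1 : ℝ) : ι → ℝ) k)).const_add (x k)

/-! ### Homogeneity, compactness and positivity for the entropy. -/

section Entropy

variable {ι : Type*} [Fintype ι] {π : ι → ℝ}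

lemma normSq_eq (π x : ι → ℝ) : normSq π x = ∑ i, π i * x i ^ 2 := by
  simp [normSq]

/-- The integral of `x² log x²`. -/
noncomputable def sqLogSq (π x : ι → ℝ) : ℝ := ∑ i, π i * (x i ^ 2 * Real.log (x i ^ 2))

lemma entropy_eq {x : ι → ℝ} (hx : normSq π x ≠ 0) :
    entropy π x = sqLogSq π x - normSq π x * Real.log (normSq π x) := by
  have h : ∀ i, |x i| ^ 2 * Real.log (|x i| ^ 2 / normSq π x) * π i =
      π i * (x i ^ 2 * Real.log (x i ^ 2)) - π i * x i ^ 2 * Real.log (normSq π x) := by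
    intro i
    rw [sq_abs]
    rcases eq_or_ne (x i) 0 with h0 | h0
    · simp [h0]
    · rw [Real.log_div (pow_ne_zero 2 h0) hx]
      ring
  simp only [entropy, h, Finset.sum_sub_distrib, ← Finset.sum_mul, sqLogSq, ← normSq_eq]

lemma continuous_normSq : Continuous (normSq π) := by
  have : normSq π = fun x => ∑ i, π i * x i ^ 2 := funext (normSq_eq π)
  rw [this]
  fun_prop

lemma continuous_sqLogSq : Continuous (sqLogSq π) := by
  unfold sqLogSq
  refine continuous_finsetSum _ fun i _ => continuous_const.mul ?_
  exact Real.continuous_mul_log.comp ((continuous_apply i).pow 2)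

lemma normSq_smul (c : ℝ) (x : ι → ℝ) : normSq π (c • x) = c ^ 2 * normSq π x := by
  simp only [normSq_eq, Finset.mul_sum, Pi.smul_apply, smul_eq_mul]
  exact Finset.sum_congr rfl fun i _ => by ring

lemma sqLogSq_smul {c : ℝ} (hc : c ≠ 0) (x : ι → ℝ) :
    sqLogSq π (c • x) = c ^ 2 * (sqLogSq π x + normSq π x * Real.log (c ^ 2)) := by
  simp only [normSq_eq, sqLogSq, Finset.sum_mul, Finset.mul_sum, Pi.smul_apply, smul_eq_mul,
    ← Finset.sum_add_distrib]
  refine Finset.sum_congr rfl fun i _ => ?_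
  rcases eq_or_ne (x i) 0 with h0 | h0
  · simp [h0]
  · rw [mul_pow, Real.log_mul (pow_ne_zero 2 hc) (pow_ne_zero 2 h0)]
    ring

lemma normSq_pos (hπ : ∀ i, 0 < π i) {x : ι → ℝ} {i : ι} (hi : x i ≠ 0) : 0 < normSq π x := by
  rw [normSq_eq]
  exact Finset.sum_pos' (fun k _ => mul_nonneg (hπ k).le (sq_nonneg _))
    ⟨i, Finset.mem_univ i, mul_pos (hπ i) (by positivity)⟩

lemma isCompact_unitSphere_inter_nonneg (hπ : ∀ i, 0 < π i) :
    IsCompact {x : ι → ℝ | 0 ≤ x ∧ normSq π x = 1} := by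
  refine IsCompact.of_isClosed_subset (isCompact_Icc (a := (0 : ι → ℝ))
    (b := fun i => Real.sqrt (1 / π i))) ?_ ?_
  · exact (isClosed_le continuous_const continuous_id).inter
      (isClosed_eq continuous_normSq continuous_const)
  · rintro x ⟨h0, h1⟩
    refine ⟨h0, fun i => Real.le_sqrt_of_sq_le ?_⟩
    rw [le_div_iff₀ (hπ i), mul_comm, ← h1, normSq_eq]
    exact Finset.single_le_sum (f := fun i => π i * x i ^ 2)
      (fun k _ => mul_nonneg (hπ k).le (sq_nonneg _)) (Finset.mem_univ i)

/-- With `N = normSq π x`, `a log(a/N) ≥ a - N`, strictly unless `a = N`. The right side at `a =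
x_k²` has `π`-mean zero, and the `x_k²` cannot all equal `N`. -/
lemma entropy_pos (hπ : ∀ i, 0 < π i) (hsum : ∑ i, π i = 1) {x : ι → ℝ} (hx : ∀ i, 0 < x i)
    {i j : ι} (hij : x i ≠ x j) : 0 < entropy π x := by
  have hN : 0 < normSq π x := normSq_pos hπ (hx i).ne'
  have hrw : ∀ k, |x k| ^ 2 * Real.log (|x k| ^ 2 / normSq π x) =
      -(x k ^ 2 * Real.log (normSq π x / x k ^ 2)) := by
    intro k
    rw [sq_abs, ← inv_div, Real.log_inv]
    ring
  have hlin : ∀ k, x k ^ 2 - normSq π x = -(x k ^ 2 * (normSq π x / x k ^ 2 - 1)) := by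
    intro k
    have := (hx k).ne'
    field_simp
    ring
  have hle : ∀ k, (x k ^ 2 - normSq π x) * π k ≤
      |x k| ^ 2 * Real.log (|x k| ^ 2 / normSq π x) * π k := by
    intro k
    have hk := hx k
    rw [hrw, hlin]
    have := Real.log_le_sub_one_of_pos (x := normSq π x / x k ^ 2) (by positivity)
    exact mul_le_mul_of_nonneg_right
      (neg_le_neg (mul_le_mul_of_nonneg_left this (by positivity))) (hπ k).le
  have hlt : ∀ k, x k ^ 2 ≠ normSq π x → (x k ^ 2 - normSq π x) * π k <
      |x k| ^ 2 * Real.log (|x k| ^ 2 / normSq π x) * π k := by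
    intro k hne
    have hk := hx k
    rw [hrw, hlin]
    have := Real.log_lt_sub_one_of_pos (x := normSq π x / x k ^ 2) (by positivity)
      (fun h => hne ((div_eq_one_iff_eq (by positivity)).1 h).symm)
    exact mul_lt_mul_of_pos_right
      (neg_lt_neg (mul_lt_mul_of_pos_left this (by positivity))) (hπ k)
  have hex : ∃ k, x k ^ 2 ≠ normSq π x := by
    by_contra! h
    refine hij ((sq_eq_sq₀ (hx i).le (hx j).le).1 ?_)
    rw [h i, h j]
  obtain ⟨k, hk⟩ := hex
  calc (0 : ℝ) = ∑ k, (x k ^ 2 - normSq π x) * π k := by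
        simp only [sub_mul, Finset.sum_sub_distrib, ← Finset.mul_sum, hsum, mul_one]
        rw [normSq_eq, sub_eq_zero.2]
        exact Finset.sum_congr rfl fun i _ => mul_comm _ _
    _ < _ := Finset.sum_lt_sum (fun k _ => hle k) ⟨k, Finset.mem_univ k, hlt k hk⟩

end Entropy

/-! ### The variational problem for `𝒟 - sℰ`. -/

section LogSobolev

variable {ι : Type*} [Fintype ι] [DecidableEq ι] {K : Matrix ι ι ℝ} {π : ι → ℝ}

lemma dirichlet_eq (x y : ι → ℝ) :
    dirichlet K π x y = ∑ i, π i * x i * (y i - (K *ᵥ y) i) := by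
  simp [dirichlet, inn, dotProduct, Matrix.mulVec_diagonal, Matrix.sub_mulVec]

lemma dirichlet_add_left (x y z : ι → ℝ) :
    dirichlet K π (x + y) z = dirichlet K π x z + dirichlet K π y z := by
  simp [dirichlet, inn, Matrix.mulVec_add, add_dotProduct]

lemma dirichlet_add_right (x y z : ι → ℝ) :
    dirichlet K π x (y + z) = dirichlet K π x y + dirichlet K π x z := by
  simp [dirichlet, inn, Matrix.mulVec_add, dotProduct_add]

lemma dirichlet_smul_left (c : ℝ) (x y : ι → ℝ) :
    dirichlet K π (c • x) y = c * dirichlet K π x y := by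
  simp [dirichlet, inn, Matrix.mulVec_smul]

lemma dirichlet_smul_right (c : ℝ) (x y : ι → ℝ) :
    dirichlet K π x (c • y) = c * dirichlet K π x y := by
  simp [dirichlet, inn, Matrix.mulVec_smul]

lemma hasDerivAt_sqLogSq (x : ι → ℝ) (i : ι) :
    HasDerivAt (fun u : ℝ => sqLogSq π (x + u • Pi.single i 1))
      (π i * (2 * x i * Real.log (x i ^ 2) + 2 * x i)) 0 := by
  have h : ∀ k ∈ Finset.univ, HasDerivAt (fun u : ℝ => π k * ((x + u • (Pi.single i 1 : ι → ℝ)) k ^ 2 *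
      Real.log ((x + u • (Pi.single i 1 : ι → ℝ)) k ^ 2)))
      (π k * ((2 * x k * Real.log (x k ^ 2) + 2 * x k) * (Pi.single i (1 : ℝ) : ι → ℝ) k)) 0 := by
    intro k _
    have := hasDerivAt_sq_mul_log_sq ((x + (0 : ℝ) • (Pi.single i 1 : ι → ℝ)) k)
    have h := (this.comp (0 : ℝ) (hasDerivAt_coord x i k)).const_mul (π k)
    simp only [zero_smul, add_zero] at h
    exact h
  have := HasDerivAt.fun_sum h
  convert! this using 1
  simp [Pi.single_apply]

lemma hasDerivAt_normSq (x : ι → ℝ) (i : ι) :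
    HasDerivAt (fun u : ℝ => normSq π (x + u • Pi.single i 1)) (2 * π i * x i) 0 := by
  have h : ∀ k ∈ Finset.univ, HasDerivAt (fun u : ℝ => π k * (x + u • (Pi.single i 1 : ι → ℝ)) k ^ 2)
      (π k * (2 * x k * (Pi.single i (1 : ℝ) : ι → ℝ) k)) 0 := by
    intro k _
    have h := ((hasDerivAt_coord x i k).fun_pow 2).const_mul (π k)
    simpa using h
  have := HasDerivAt.fun_sum h
  simp only [normSq_eq]
  convert! this using 1
  simp [Pi.single_apply]
  ring

/-- The gradient of `x ↦ 𝒟(x, x)`: symmetrizing the form is what brings in `K + K*`. -/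
lemma dirichlet_single_add (hπ : ∀ i, 0 < π i) (x : ι → ℝ) (i : ι) :
    dirichlet K π x (Pi.single i 1) + dirichlet K π (Pi.single i 1) x =
      π i * (2 * x i - ((K + adj π K) *ᵥ x) i) := by
  have h1 : dirichlet K π (Pi.single i 1) x = π i * (x i - (K *ᵥ x) i) := by
    simp [dirichlet_eq, Pi.single_apply]
  have h2 : dirichlet K π x (Pi.single i 1) = π i * (x i - (adj π K *ᵥ x) i) := by
    have h3 : π i * (adj π K *ᵥ x) i = ∑ k, π k * x k * K k i := by
      simp only [Matrix.mulVec, dotProduct, adj_apply, Finset.mul_sum]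
      refine Finset.sum_congr rfl fun k _ => ?_
      have := (hπ i).ne'
      field_simp
    rw [mul_sub, h3]
    simp [dirichlet_eq, mul_sub, Finset.sum_sub_distrib, Pi.single_apply]
  rw [h1, h2, Matrix.add_mulVec, Pi.add_apply]
  ring

lemma hasDerivAt_dirichlet (hπ : ∀ i, 0 < π i) (x : ι → ℝ) (i : ι) :
    HasDerivAt (fun u : ℝ => dirichlet K π (x + u • Pi.single i 1) (x + u • Pi.single i 1))
      (π i * (2 * x i - ((K + adj π K) *ᵥ x) i)) 0 := by
  rw [← dirichlet_single_add hπ]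
  simp only [dirichlet_add_left, dirichlet_add_right, dirichlet_smul_left, dirichlet_smul_right]
  set a := dirichlet K π x x
  set b := dirichlet K π x (Pi.single i 1)
  set c := dirichlet K π (Pi.single i 1) x
  set d := dirichlet K π (Pi.single i 1) (Pi.single i 1)
  have hid := hasDerivAt_id' (0 : ℝ)
  have h := ((hid.mul_const b).const_add a).add ((hid.mul_const c).add (hid.mul (hid.mul_const d)))
  convert! h using 1
  · ext u
    simp only [Pi.add_apply, Pi.mul_apply]
    ring
  · simp

lemma continuous_dirichlet_self : Continuous fun x : ι → ℝ => dirichlet K π x x := by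
  simp only [dirichlet_eq, Matrix.mulVec, dotProduct]
  fun_prop

/-- The functional `𝒟 - s ℰ` attains its infimum `m` over the nonnegative part of the sphere. -/
lemma exists_minimizer (hπ : ∀ i, 0 < π i) (hsum : ∑ i, π i = 1) (s : ℝ) :
    ∃ (m : ℝ) (x : ι → ℝ), 0 ≤ x ∧ normSq π x = 1 ∧
      dirichlet K π x x - s * sqLogSq π x = m ∧
      ∀ y, 0 ≤ y → 0 < normSq π y → m * normSq π y ≤ dirichlet K π y y -
        s * (sqLogSq π y - normSq π y * Real.log (normSq π y)) := by
  obtain ⟨x, ⟨hx0, hx1⟩, hmin⟩ := (isCompact_unitSphere_inter_nonneg hπ).exists_isMinOn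
    ⟨1, fun _ => zero_le_one, by simpa [normSq_eq] using hsum⟩
    (f := fun x => dirichlet K π x x - s * sqLogSq π x)
    (continuous_dirichlet_self.sub (continuous_const.mul continuous_sqLogSq)).continuousOn
  refine ⟨_, x, hx0, hx1, rfl, fun y hy0 hy => ?_⟩
  set N := normSq π y
  -- Both sides are homogeneous of degree two, so normalizing `y` suffices.
  set c := (Real.sqrt N)⁻¹
  have hc : 0 < c := inv_pos.2 (Real.sqrt_pos.2 hy)
  have hc2 : c ^ 2 = N⁻¹ := by rw [inv_pow, Real.sq_sqrt hy.le]
  have h := isMinOn_iff.1 hmin (c • y) ⟨fun i => mul_nonneg hc.le (hy0 i), by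
    rw [normSq_smul, hc2]
    exact inv_mul_cancel₀ hy.ne'⟩
  rw [dirichlet_smul_left, dirichlet_smul_right, sqLogSq_smul hc.ne', hc2, Real.log_inv,
    ← mul_assoc, ← sq, hc2] at h
  have := mul_le_mul_of_nonneg_right h hy.le
  refine this.trans (le_of_eq ?_)
  have hN : N ≠ 0 := hy.ne'
  field_simp
  simp only [N]
  ring

/-- The first-order conditions at a minimizer of `𝒟 - s ℰ`. -/
lemma first_order_conditions (hπ : ∀ i, 0 < π i) {s m : ℝ} {x : ι → ℝ} (hx0 : 0 ≤ x)
    (hx1 : normSq π x = 1) (hm : dirichlet K π x x - s * sqLogSq π x = m)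
    (hmin : ∀ y, 0 ≤ y → 0 < normSq π y → m * normSq π y ≤ dirichlet K π y y -
        s * (sqLogSq π y - normSq π y * Real.log (normSq π y))) (i : ι) :
    0 ≤ 2 * x i - ((K + adj π K) *ᵥ x) i - 2 * s * x i * Real.log (x i ^ 2) - 2 * m * x i ∧
    (0 < x i →
      2 * x i - ((K + adj π K) *ᵥ x) i - 2 * s * x i * Real.log (x i ^ 2) - 2 * m * x i = 0) := by
  set E := 2 * x i - ((K + adj π K) *ᵥ x) i - 2 * s * x i * Real.log (x i ^ 2) - 2 * m * x i
    with hE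
  let c : ℝ → ι → ℝ := fun u => x + u • Pi.single i 1
  have c0 : c 0 = x := by simp [c]
  let f : ℝ → ℝ := fun u => dirichlet K π (c u) (c u) -
    s * (sqLogSq π (c u) - normSq π (c u) * Real.log (normSq π (c u))) - m * normSq π (c u)
  have hf0 : f 0 = 0 := by simp [f, c0, hx1, ← hm]
  have hN := hasDerivAt_normSq (π := π) x i
  have hf : HasDerivAt f (π i * E) 0 := by
    have hN0 : normSq π (x + (0 : ℝ) • Pi.single i 1) ≠ 0 := by simp [hx1]
    have hlog := (Real.hasDerivAt_mul_log hN0).comp (0 : ℝ) hN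
    have := ((hasDerivAt_dirichlet (K := K) hπ x i).sub
      (((hasDerivAt_sqLogSq (π := π) x i).sub hlog).const_mul s)).sub (hN.const_mul m)
    convert! this using 1
    simp [hx1, hE]
    ring
  have hNpos : ∀ᶠ u in 𝓝 (0 : ℝ), 0 < normSq π (c u) :=
    hN.continuousAt.eventually (lt_mem_nhds (by simp [hx1]))
  -- Moves with `u > 0` are always allowed and give the inequality; if `x i > 0`, small moves of
  -- both signs are allowed and give equality.
  have hfpos : ∀ u, 0 < normSq π (c u) → 0 ≤ x i + u → 0 ≤ f u := by
    intro u hu hxu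
    refine sub_nonneg.2 (hmin (c u) (fun k => ?_) hu)
    rcases eq_or_ne k i with rfl | hk
    · simpa [c] using hxu
    · simpa [c, hk] using hx0 k
  constructor
  · have := nonneg_of_hasDerivAt_zero hf hf0 (by
      filter_upwards [hNpos.filter_mono nhdsWithin_le_nhds, self_mem_nhdsWithin] with u hu hu0
      exact hfpos u hu (add_nonneg (hx0 i) (le_of_lt hu0)))
    exact nonneg_of_mul_nonneg_right this (hπ i)
  · intro hxi
    have hloc : IsLocalMin f 0 := by
      filter_upwards [hNpos, Ioi_mem_nhds (neg_lt_zero.2 hxi)] with u hu hu0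
      rw [hf0]
      have : -x i < u := hu0
      exact hfpos u hu (by linarith)
    exact (mul_eq_zero.1 (hloc.hasDerivAt_eq_zero hf)).resolve_left (hπ i).ne'

/-- At a zero `k` of `x`, the nonnegative sum `(A x) k` vanishes, so `A k l = 0` for all `l` in the
support. No power of `A` then links the zero set to the support, contrary to irreducibility. -/
lemma pos_of_irreducible {A : Matrix ι ι ℝ} (hA : A.IsIrreducible) {x : ι → ℝ} (hx0 : 0 ≤ x)
    (hx : x ≠ 0) (h : ∀ i, x i = 0 → (A *ᵥ x) i ≤ 0) (i : ι) : 0 < x i := by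
  refine (hx0 i).lt_of_ne' fun hi => ?_
  obtain ⟨j, hj⟩ := Function.ne_iff.1 hx
  have hzero : ∀ k l, x k = 0 → x l ≠ 0 → A k l = 0 := by
    intro k l hk hl
    have hnn : ∀ l ∈ Finset.univ, 0 ≤ A k l * x l := fun l _ => mul_nonneg (hA.nonneg k l) (hx0 l)
    have h0 := (Finset.sum_eq_zero_iff_of_nonneg hnn).1
      (le_antisymm (h k hk) (Finset.sum_nonneg hnn)) l (Finset.mem_univ l)
    exact (mul_eq_zero.1 h0).resolve_right hl
  have hpow : ∀ n : ℕ, ∀ k l, x k = 0 → x l ≠ 0 → (A ^ n) k l = 0 := by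
    intro n
    induction n with
    | zero =>
      intro k l hk hl
      rw [pow_zero, Matrix.one_apply_ne]
      rintro rfl
      exact hl hk
    | succ n ih =>
      intro k l hk hl
      rw [pow_succ, Matrix.mul_apply]
      refine Finset.sum_eq_zero fun p _ => ?_
      by_cases hp : x p = 0
      · rw [hzero p l hp hl, mul_zero]
      · rw [ih k p hk hp, zero_mul]
  obtain ⟨n, -, hn⟩ := (Matrix.isIrreducible_iff_exists_pow_pos hA.nonneg).1 hA i j
  exact hn.ne' (hpow n i j hi hj)

/-- An exponential contraction rate `l` of the semigroup in Hilbert's metric yields the logarithmic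
Sobolev inequality with every constant `s < l / 2`. -/
theorem mul_entropy_le_dirichlet (hK : IsMarkovChain K π) (hπ : ∀ i, 0 < π i)
    (hirr : (K + adj π K).IsIrreducible) {l s : ℝ} (hsl : 2 * s < l)
    (hl : ∀ t : ℝ, 0 < t → rho K π t ≤ ENNReal.ofReal (Real.exp (-(l * t))))
    {y : ι → ℝ} (hy : ∀ i, 0 < y i) : s * entropy π y ≤ dirichlet K π y y := by
  obtain ⟨m, x, hx0, hx1, hm, hmin⟩ := exists_minimizer (K := K) hπ hK.prob.2 s
  have hfoc := first_order_conditions hπ hx0 hx1 hm hmin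
  have hxne : x ≠ 0 := by
    rintro rfl
    simp [normSq_eq] at hx1
  -- At a zero coordinate the terms with factor `x i`, including the logarithmic one, drop out,
  -- leaving `(A x) i ≤ 0`.
  have hx : ∀ i, 0 < x i := pos_of_irreducible hirr hx0 hxne fun i hi => by
    have := (hfoc i).1
    rw [hi] at this
    linarith
  have hne : Nonempty ι := by
    obtain ⟨i, -⟩ := Function.ne_iff.1 hxne
    exact ⟨i⟩
  obtain ⟨i, hi⟩ := Finite.exists_max x
  obtain ⟨j, hj⟩ := Finite.exists_min x
  have hcrit : ∀ k, ((K + adj π K) *ᵥ x) k / x k = 2 - 4 * s * Real.log (x k) - 2 * m := by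
    intro k
    have h := (hfoc k).2 (hx k)
    rw [div_eq_iff (hx k).ne']
    rw [Real.log_pow] at h
    push_cast at h
    linarith
  have hrow := hK.add_adj_mulVec_one hπ
  have hineq := mulVec_div_sub_le hrow hl hx hi hj
  rw [hcrit, hcrit, Real.log_div (hx i).ne' (hx j).ne'] at hineq
  have hlog : Real.log (x i) ≤ Real.log (x j) := by
    by_contra! hcon
    nlinarith
  have hij : x i ≤ x j := (Real.log_le_log_iff (hx i) (hx j)).1 hlog
  have hconst : x = x i • 1 := by
    ext k
    simpa using le_antisymm (hi k) (hij.trans (hj k))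
  have hxi : x i ^ 2 = 1 := by
    have h1 : normSq π 1 = 1 := by simpa [normSq_eq] using hK.prob.2
    rw [hconst, normSq_smul, h1, mul_one] at hx1
    exact hx1
  have hxi1 : x i = 1 := (pow_eq_one_iff_of_nonneg (hx i).le two_ne_zero).1 hxi
  -- Since `x = 1`, the critical equation reads `2 = 2 - 2m`.
  have hm0 : m = 0 := by
    have h := hcrit i
    have h2 : ((K + adj π K) *ᵥ x) i = 2 := by
      rw [hconst, hxi1, one_smul]
      exact hrow i
    rw [h2, hxi1, Real.log_one] at h
    linarith
  obtain ⟨i₀⟩ := hne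
  have hN := normSq_pos hπ (hy i₀).ne'
  have := hmin y (fun k => (hy k).le) hN
  rw [hm0, zero_mul, ← entropy_eq hN.ne'] at this
  linarith

/-- One nonconstant test vector suffices: every admissible `s` is at most `𝒟/ℰ` there. -/
lemma logSobolev_ne_top (hπ : ∀ i, 0 < π i) (hsum : ∑ i, π i = 1)
    (hcard : 2 ≤ Fintype.card ι) : logSobolev K π ≠ ⊤ := by
  obtain ⟨i, j, hij⟩ := Fintype.one_lt_card_iff.1 hcard
  let x : ι → ℝ := fun k => if k = i then 2 else 1
  have hx : ∀ k, 0 < x k := fun k => by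
    simp only [x]
    split_ifs <;> norm_num
  have hE : 0 < entropy π x := entropy_pos hπ hsum hx (i := i) (j := j) (by simp [x, hij.symm])
  refine ((iSup₂_le fun s hs => ?_).trans_lt
    (ENNReal.ofReal_lt_top (r := dirichlet K π x x / entropy π x))).ne
  rw [← ENNReal.ofReal_coe_nnreal]
  exact ENNReal.ofReal_le_ofReal ((le_div_iff₀ hE).2 (hs x hx))

end LogSobolev

end BirkhoffLogSobolev

/-! ### Conclusion: comparing the limit with `e^(2σ)`. -/

theorem mainTheorem10 {ι : Type*} [Fintype ι] [DecidableEq ι]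
    (K : Matrix ι ι ℝ) (π : ι → ℝ)
    (hK : BirkhoffLogSobolev.IsMarkovChain K π)
    (hπ : ∀ i, 0 < π i)
    (hirr : (K + BirkhoffLogSobolev.adj π K).IsIrreducible) :
    ∃ L : ℝ≥0∞,
      Tendsto (fun t : ℝ => BirkhoffLogSobolev.rho K π t ^ (-1 / t)) (𝓝[>] 0) (𝓝 L) ∧
      (2 ≤ Fintype.card ι → L ≠ ⊤) ∧
      L ≤ EReal.exp ((2 * BirkhoffLogSobolev.logSobolev K π : ℝ≥0∞) : EReal) := by
  open BirkhoffLogSobolev in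
  set L : ℝ≥0∞ := ⨅ (t : ℝ) (_ : 0 < t), rho K π t ^ (-1 / t)
  have hle : L ≤ EReal.exp ((2 * logSobolev K π : ℝ≥0∞) : EReal) := by
    by_contra! hcon
    -- Two intermediate reals `a < b` supply the strict gap `2s < l`, with `s = log a / 2` and `l =
    -- log b`.
    obtain ⟨b, hb, hb1, hb2⟩ := ENNReal.lt_iff_exists_real_btwn.1 hcon
    obtain ⟨a, ha, ha1, ha2⟩ := ENNReal.lt_iff_exists_real_btwn.1 hb1
    have h1a : 1 < a := by
      have h : (1 : ℝ≥0∞) ≤ EReal.exp ((2 * logSobolev K π : ℝ≥0∞) : EReal) :=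
        EReal.one_le_exp_iff.2 (EReal.coe_ennreal_nonneg _)
      exact ENNReal.one_lt_ofReal.1 (h.trans_lt ha1)
    have hab : a < b := ENNReal.ofReal_lt_ofReal_iff'.1 ha2 |>.1
    have ha0 : 0 < a := one_pos.trans h1a
    have hb0 : 0 < b := ha0.trans hab
    have hlog : 2 * (Real.log a / 2) < Real.log b := by
      rw [mul_div_cancel₀ _ two_ne_zero]
      exact Real.log_lt_log ha0 hab
    have hrate : ∀ t : ℝ, 0 < t →
        rho K π t ≤ ENNReal.ofReal (Real.exp (-(Real.log b * t))) := by
      intro t ht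
      have h : ENNReal.ofReal b ≤ rho K π t ^ (-1 / t) := hb2.le.trans (iInf₂_le t ht)
      have h' := ENNReal.inv_le_inv.2 (ENNReal.rpow_le_rpow h ht.le)
      rwa [← ENNReal.rpow_mul, div_mul_cancel₀ _ ht.ne', ENNReal.rpow_neg_one, inv_inv,
        ← ENNReal.rpow_neg, ENNReal.ofReal_rpow_of_pos hb0, Real.rpow_def_of_pos hb0,
        mul_neg] at h'
    have hs : ENNReal.ofReal (Real.log a / 2) ≤ logSobolev K π := by
      refine le_iSup₂_of_le (Real.log a / 2).toNNReal (fun y hy => ?_) le_rfl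
      rw [Real.coe_toNNReal _ (div_nonneg (Real.log_nonneg h1a.le) two_pos.le)]
      exact mul_entropy_le_dirichlet hK hπ hirr hlog hrate hy
    have h2s : ENNReal.ofReal (Real.log a) ≤ 2 * logSobolev K π := by
      calc ENNReal.ofReal (Real.log a) = 2 * ENNReal.ofReal (Real.log a / 2) := by
            rw [← ENNReal.ofReal_ofNat 2, ← ENNReal.ofReal_mul (by norm_num),
              mul_div_cancel₀ _ two_ne_zero]
        _ ≤ _ := by gcongr
    refine ha1.not_ge ?_
    calc ENNReal.ofReal a = EReal.exp ((Real.log a : ℝ) : EReal) := by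
          rw [EReal.exp_coe, Real.exp_log ha0]
      _ ≤ _ := by
          refine EReal.exp_le_exp_iff.2 ?_
          rw [← max_eq_left (Real.log_nonneg h1a.le), ← EReal.coe_ennreal_ofReal]
          exact EReal.coe_ennreal_le_coe_ennreal_iff.2 h2s
  refine ⟨L, tendsto_rpow_neg_inv_of_submultiplicative (rho_le_one hirr.nonneg)
    (rho_add_le hirr.nonneg), fun hcard => ?_, hle⟩
  refine (hle.trans_lt (EReal.exp_lt_top_iff.2 (lt_top_iff_ne_top.2 ?_))).ne
  rw [Ne, EReal.coe_ennreal_eq_top_iff]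
  exact ENNReal.mul_ne_top (by simp) (logSobolev_ne_top hπ hK.prob.2 hcard)
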